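/- Let $a_1,b_0,b_2\in\mathbb{R}$ and consider the real planar system $$\dot x = y-\tfrac13x^2+a_1xy,\qquad \dot y = 2x^3-\tfrac23xy+b_0x^4+b_2y^2 .$$ An analytic first integral of a vector field $F$ on an open set $U\subseteq\mathbb{R}^2$ is a real analytic function $H:U\to\mathbb{R}$ that is not constant on any nonempty open subset of $U$ and satisfies $\nabla H\cdot F=0$ on $U$. The system is called analytically integrable (at the origin) if it has an analytic first integral on some open neighbourhood of $(0,0)$. Theorem. The system is analytically integrable at the origin if and only if $a_1=0$ and $b_0+b_2=0$. In that case $$I(x,y)=(y-x^2)(y+x^2)^2e^{-3b_2x}$$ is an analytic first integral of the system on all of $\mathbb{R}^2$. -/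

import Mathlib

/-- `H` is an analytic first integral of the planar vector field `F` on the set `U` (meant to be
open): `H` is real analytic on `U`, its derivative along `F` vanishes identically on `U`
(`∇H · F = 0`), and `H` is not constant on any nonempty open subset of `U`. -/
structure IsAnalyticFirstIntegralOn (F : ℝ × ℝ → ℝ × ℝ) (U : Set (ℝ × ℝ))
    (H : ℝ × ℝ → ℝ) : Prop where
  analytic : AnalyticOnNhd ℝ H U
  lieDeriv_eq_zero : ∀ p ∈ U, fderiv ℝ H p (F p) = 0
  nonconstant : ∀ V : Set (ℝ × ℝ), V ⊆ U → IsOpen V → V.Nonempty →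
    ¬ ∃ c : ℝ, ∀ p ∈ V, H p = c

/-- The vector field `F` is analytically integrable at `p`: it has an analytic first integral on
some open neighbourhood of `p`. -/
def IsAnalyticallyIntegrableAt (F : ℝ × ℝ → ℝ × ℝ) (p : ℝ × ℝ) : Prop :=
  ∃ U : Set (ℝ × ℝ), IsOpen U ∧ p ∈ U ∧ ∃ H : ℝ × ℝ → ℝ, IsAnalyticFirstIntegralOn F U H

/-- The vector field of the system
`ẋ = y - x²/3 + a₁ x y`, `ẏ = 2x³ - (2/3) x y + b₀ x⁴ + b₂ y²`. -/
noncomputable def nilpotentField (a₁ b₀ b₂ : ℝ) (p : ℝ × ℝ) : ℝ × ℝ :=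
  (p.2 - p.1 ^ 2 / 3 + a₁ * p.1 * p.2,
    2 * p.1 ^ 3 - 2 / 3 * p.1 * p.2 + b₀ * p.1 ^ 4 + b₂ * p.2 ^ 2)

/-! ### Weighted expansion of a planar power series. -/

open Filter Topology Asymptotics Polynomial

/-! Give x weight 1 and y weight 2, i.e. blow up (x, y) = (ρ, ρ²w). The Taylor series of a first
integral becomes ∑ ρ^k h_k(w) with deg h_k ≤ k/2, and ∇H·F = 0 becomes the recursion
`IsWeightedIntegral`: a first-order linear ODE for h_{k+1} with source h_k, singular at w = ±1, the
invariant curves y = ±x² of the leading field.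

The lowest nonzero part must be c(w-1)^j(w+1)^(2j) with k = 6j
(`exists_eq_of_weightedLieDeriv_eq_zero`). Each of the next three parts loses at most one factor w-1
and one factor w+1 (`IsWeightedIntegral.exists_succ_eq`), so the cofactors have degree at most 2, 5,
7 whatever j is, and satisfy small linear systems. The first is overdetermined and forces 27(b₀+b₂)
+ 58a₁ = 0; the second imposes nothing; the third forces a₁ times a definite quadratic form to
vanish. Hence a₁ = 0, and then b₀ + b₂ = 0. Passing to (H - H(0))^18 guarantees j ≥ 3, so that three
steps are available.

Conversely, the given I is checked by differentiation. -/

theorem Polynomial.coeff_eq_zero_of_isBigO_pow {p : ℝ[X]} {N : ℕ}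
    (h : (fun x => p.eval x) =O[𝓝 0] fun x : ℝ => x ^ N) {k : ℕ} (hk : k < N) :
    p.coeff k = 0 := by
  by_cases hp : p = 0
  · simp [hp]
  obtain ⟨q, hq, hdvd⟩ := p.exists_eq_pow_rootMultiplicity_mul_and_not_dvd hp 0
  set e := p.rootMultiplicity 0
  have hq0 : q.eval 0 ≠ 0 := fun h0 => hdvd (dvd_iff_isRoot.2 h0)
  simp only [map_zero, sub_zero] at hq
  have he : N ≤ e := by
    by_contra! hlt
    have h1 : (fun x => q.eval x) =O[𝓝[≠] 0] fun x : ℝ => x ^ (N - e) := by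
      have h2 := (h.mono nhdsWithin_le_nhds).mul
        (isBigO_refl (fun x : ℝ => (x ^ e)⁻¹) (𝓝[≠] (0 : ℝ)))
      refine h2.congr' ?_ ?_
      · filter_upwards [self_mem_nhdsWithin] with x hx
        have : x ≠ 0 := hx
        rw [hq]
        simp only [eval_mul, eval_pow, eval_X]
        field_simp
      · filter_upwards [self_mem_nhdsWithin] with x hx
        have : x ≠ 0 := hx
        rw [← Nat.sub_add_cancel hlt.le, pow_add]
        simp only [Nat.add_sub_cancel]
        field_simp
    have h3 : Tendsto (fun x : ℝ => x ^ (N - e)) (𝓝[≠] 0) (𝓝 0) := by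
      have : ContinuousAt (fun x : ℝ => x ^ (N - e)) 0 := by fun_prop
      have h4 := this.tendsto
      simp only [zero_pow (Nat.sub_ne_zero_of_lt hlt)] at h4
      exact h4.mono_left nhdsWithin_le_nhds
    have h5 := h1.trans_tendsto h3
    have h6 : Tendsto (fun x => q.eval x) (𝓝[≠] 0) (𝓝 (q.eval 0)) :=
      q.continuous.continuousAt.tendsto.mono_left nhdsWithin_le_nhds
    exact hq0 (tendsto_nhds_unique h6 h5)
  rw [hq, coeff_X_pow_mul', if_neg (by omega)]

/-- The coefficient of `x ^ (n - i) * y ^ i` in the `n`-th term of a formal power series in two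
variables. -/
noncomputable def FormalMultilinearSeries.planarCoeff
    (p : FormalMultilinearSeries ℝ (ℝ × ℝ) ℝ) (n i : ℕ) : ℝ :=
  ∑ s ∈ Finset.powersetCard i (Finset.univ : Finset (Fin n)),
    p n (s.piecewise (fun _ => ((0 : ℝ), (1 : ℝ))) (fun _ => (1, 0)))

theorem FormalMultilinearSeries.apply_diag_eq_sum_planarCoeff
    (p : FormalMultilinearSeries ℝ (ℝ × ℝ) ℝ) (n : ℕ) (x y : ℝ) :
    p n (fun _ => (x, y)) =
      ∑ i ∈ Finset.range (n + 1), p.planarCoeff n i * (x ^ (n - i) * y ^ i) := by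
  have h1 : (fun _ : Fin n => (x, y)) =
      (fun _ => y • ((0 : ℝ), (1 : ℝ))) + (fun _ => x • ((1 : ℝ), (0 : ℝ))) := by
    ext i <;> simp
  rw [h1, ContinuousMultilinearMap.map_add_univ, ← Finset.powerset_univ,
    Finset.sum_powerset]
  simp only [Finset.card_univ, Fintype.card_fin]
  refine Finset.sum_congr rfl fun i _ => ?_
  rw [FormalMultilinearSeries.planarCoeff, Finset.sum_mul]
  refine Finset.sum_congr rfl fun s hs => ?_
  have h2 : s.piecewise (fun _ : Fin n => y • ((0 : ℝ), (1 : ℝ)))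
      (fun _ => x • ((1 : ℝ), (0 : ℝ))) =
      fun j => (s.piecewise (fun _ => y) (fun _ => x) : Fin n → ℝ) j •
        (s.piecewise (fun _ => ((0 : ℝ), (1 : ℝ))) (fun _ => (1, 0)) : Fin n → ℝ × ℝ) j := by
    funext j
    by_cases hj : j ∈ s <;> simp [hj]
  rw [h2, ContinuousMultilinearMap.map_smul_univ, Finset.prod_piecewise]
  have h3 := (Finset.mem_powersetCard.1 hs).2
  simp only [Finset.univ_inter, Finset.prod_const, h3, smul_eq_mul]
  rw [show (Finset.univ \ s).card = n - i by
    rw [Finset.card_sdiff_of_subset (Finset.subset_univ s), h3]; simp]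
  ring

/-- The coefficient of `ρ ^ k` in the expansion, after the blow up `(x, y) = (ρ, ρ² w)`, of the
terms of degree less than `N` of a formal power series in two variables. -/
noncomputable def FormalMultilinearSeries.truncWeightedPart
    (p : FormalMultilinearSeries ℝ (ℝ × ℝ) ℝ) (N k : ℕ) : ℝ[X] :=
  ∑ i ∈ Finset.range (k / 2 + 1), if k - i < N then C (p.planarCoeff (k - i) i) * X ^ i else 0

/-- The coefficient of `ρ ^ k` in the expansion, after the blow up `(x, y) = (ρ, ρ² w)`, of a
formal power series in two variables. -/
noncomputable def FormalMultilinearSeries.weightedPart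
    (p : FormalMultilinearSeries ℝ (ℝ × ℝ) ℝ) (k : ℕ) : ℝ[X] :=
  ∑ i ∈ Finset.range (k / 2 + 1), C (p.planarCoeff (k - i) i) * X ^ i

namespace FormalMultilinearSeries

variable (p : FormalMultilinearSeries ℝ (ℝ × ℝ) ℝ)

theorem truncWeightedPart_of_lt {N k : ℕ} (h : k < N) :
    p.truncWeightedPart N k = p.weightedPart k := by
  refine Finset.sum_congr rfl fun i _ => ?_
  rw [if_pos (by omega)]

theorem natDegree_weightedPart_le (k : ℕ) : (p.weightedPart k).natDegree ≤ k / 2 := by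
  refine natDegree_sum_le_of_forall_le _ _ fun i hi => ?_
  have := Finset.mem_range.1 hi
  exact (natDegree_C_mul_X_pow_le _ _).trans (by omega)

theorem coeff_weightedPart {n i : ℕ} (h : i ≤ n) :
    (p.weightedPart (n + i)).coeff i = p.planarCoeff n i := by
  simp only [weightedPart, finsetSum_coeff, coeff_C_mul, coeff_X_pow]
  rw [Finset.sum_eq_single i]
  · simp
  · intro j _ hj
    simp [hj.symm]
  · intro hi
    exact absurd (Finset.mem_range.2 (by omega)) hi

theorem partialSum_blowUp (N : ℕ) (r w : ℝ) :
    p.partialSum N (r, r ^ 2 * w) =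
      ∑ k ∈ Finset.range (2 * N), r ^ k * (p.truncWeightedPart N k).eval w := by
  have h1 : ∀ k ∈ Finset.range (2 * N), r ^ k * (p.truncWeightedPart N k).eval w =
      ∑ i ∈ (Finset.range (k / 2 + 1)).filter (fun i => k - i < N),
        p.planarCoeff (k - i) i * (r ^ (k - i - i) * (r ^ 2 * w) ^ i) := by
    intro k _
    rw [truncWeightedPart, ← Finset.sum_filter, eval_finsetSum, Finset.mul_sum]
    refine Finset.sum_congr rfl fun i hi => ?_
    have := Finset.mem_range.1 (Finset.mem_filter.1 hi).1
    have h2 : r ^ k = r ^ (k - i - i) * (r ^ 2) ^ i := by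
      rw [← pow_mul, ← pow_add]; congr 1; omega
    rw [h2]
    simp only [eval_mul, eval_C, eval_pow, eval_X]
    ring
  rw [Finset.sum_congr rfl h1, partialSum]
  simp only [apply_diag_eq_sum_planarCoeff]
  rw [Finset.sum_sigma', Finset.sum_sigma']
  -- The monomial x^(n-i) y^i has degree n and weight n + i, which is below 2N because i ≤ n < N.
  refine Finset.sum_nbij' (fun t => ⟨t.1 + t.2, t.2⟩) (fun t => ⟨t.1 - t.2, t.2⟩) ?_ ?_ ?_ ?_ ?_
  · rintro ⟨n, i⟩ h
    simp only [Finset.mem_sigma, Finset.mem_range, Finset.mem_filter] at h ⊢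
    omega
  · rintro ⟨n, i⟩ h
    simp only [Finset.mem_sigma, Finset.mem_range, Finset.mem_filter] at h ⊢
    omega
  · rintro ⟨n, i⟩ h
    simp
  · rintro ⟨n, i⟩ h
    simp only [Finset.mem_sigma, Finset.mem_range, Finset.mem_filter] at h ⊢
    rw [Nat.sub_add_cancel (by omega)]
  · rintro ⟨n, i⟩ h
    simp

theorem differentiable_partialSum (N : ℕ) : Differentiable ℝ (p.partialSum N) := by
  have : p.partialSum N = fun q => ∑ n ∈ Finset.range N,
      ∑ i ∈ Finset.range (n + 1), p.planarCoeff n i * (q.1 ^ (n - i) * q.2 ^ i) := by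
    funext q
    exact Finset.sum_congr rfl fun n _ => p.apply_diag_eq_sum_planarCoeff n q.1 q.2
  rw [this]
  fun_prop

/-- The direction on the left is the image of (s, t) under the differential of the blow up. Both
sides are the derivative at τ = 0 along the blown-up line (r + τs, w + τt). -/
theorem fderiv_partialSum_blowUp (N : ℕ) (r w s t : ℝ) :
    fderiv ℝ (p.partialSum N) (r, r ^ 2 * w) (s, 2 * r * w * s + r ^ 2 * t) =
      ∑ k ∈ Finset.range (2 * N), (k * r ^ (k - 1) * s * (p.truncWeightedPart N k).eval w +
        r ^ k * ((p.truncWeightedPart N k).derivative.eval w * t)) := by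
  have hl : HasDerivAt (fun τ : ℝ => p.partialSum N (r + τ * s, (r + τ * s) ^ 2 * (w + τ * t)))
      (fderiv ℝ (p.partialSum N) (r, r ^ 2 * w) (s, 2 * r * w * s + r ^ 2 * t)) 0 := by
    have h1 : HasDerivAt (fun τ : ℝ => (r + τ * s, (r + τ * s) ^ 2 * (w + τ * t)))
        (s, 2 * r * w * s + r ^ 2 * t) 0 := by
      have ha : HasDerivAt (fun τ : ℝ => r + τ * s) s 0 := by
        simpa using ((hasDerivAt_id (0 : ℝ)).mul_const s).const_add r
      have hb : HasDerivAt (fun τ : ℝ => w + τ * t) t 0 := by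
        simpa using ((hasDerivAt_id (0 : ℝ)).mul_const t).const_add w
      convert! ha.prodMk ((ha.pow 2).mul hb) using 1
      ext <;> simp; ring
    have h2 := (p.differentiable_partialSum N (r, r ^ 2 * w)).hasFDerivAt
    have h3 : (fun τ : ℝ => (r + τ * s, (r + τ * s) ^ 2 * (w + τ * t))) 0 = (r, r ^ 2 * w) := by
      simp
    rw [← h3] at h2
    have h4 := h2.comp_hasDerivAt (0 : ℝ) h1
    rw [h3] at h4
    exact h4
  have hr : HasDerivAt (fun τ : ℝ => p.partialSum N (r + τ * s, (r + τ * s) ^ 2 * (w + τ * t)))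
      (∑ k ∈ Finset.range (2 * N), (k * r ^ (k - 1) * s * (p.truncWeightedPart N k).eval w +
        r ^ k * ((p.truncWeightedPart N k).derivative.eval w * t))) 0 := by
    simp only [partialSum_blowUp]
    refine HasDerivAt.fun_sum fun k _ => ?_
    have ha : HasDerivAt (fun τ : ℝ => r + τ * s) s 0 := by
      simpa using ((hasDerivAt_id (0 : ℝ)).mul_const s).const_add r
    have hb : HasDerivAt (fun τ : ℝ => w + τ * t) t 0 := by
      simpa using ((hasDerivAt_id (0 : ℝ)).mul_const t).const_add w
    have hc : HasDerivAt (fun τ : ℝ => (p.truncWeightedPart N k).eval (w + τ * t))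
        ((p.truncWeightedPart N k).derivative.eval w * t) 0 := by
      have := (p.truncWeightedPart N k).hasDerivAt (w + 0 * t)
      simpa [Function.comp_def] using this.comp (0 : ℝ) hb
    simpa using (ha.fun_pow k).fun_mul hc
  exact hl.unique hr

end FormalMultilinearSeries

/-! ### Taylor remainders and the recursion for the weighted parts. -/

/-- Removing the terms of degree at most N leaves a series whose derivative series starts in degree
N. -/
theorem HasFPowerSeriesAt.isBigO_fderiv_sub_fderiv_partialSum {H : ℝ × ℝ → ℝ}
    {p : FormalMultilinearSeries ℝ (ℝ × ℝ) ℝ} (hp : HasFPowerSeriesAt H p 0) (N : ℕ) :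
    (fun q => fderiv ℝ H q - fderiv ℝ (p.partialSum (N + 1)) q) =O[𝓝 0] fun q => ‖q‖ ^ N := by
  set T : FormalMultilinearSeries ℝ (ℝ × ℝ) ℝ := fun n => if n < N + 1 then p n else 0 with hT
  have h1 : HasFPowerSeriesAt (p.partialSum (N + 1)) T 0 := by
    refine (HasFiniteFPowerSeriesOnBall.mk' (n := N + 1) (r := ⊤) ?_ (by simp) ?_).hasFPowerSeriesAt
    · intro m hm
      rw [hT]
      simp only [if_neg (not_lt.2 hm)]
    · intro y _
      rw [zero_add, FormalMultilinearSeries.partialSum]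
      refine Finset.sum_congr rfl fun i hi => ?_
      simp only [hT, if_pos (Finset.mem_range.1 hi)]
  obtain ⟨r, hr⟩ := hp.sub h1
  have h2 := (hr.fderiv.hasFPowerSeriesAt).isBigO_sub_partialSum_pow N
  have h3 : ∀ y, (p - T).derivSeries.partialSum N y = 0 := by
    intro y
    refine Finset.sum_eq_zero fun n hn => ?_
    have := Finset.mem_range.1 hn
    rw [FormalMultilinearSeries.derivSeries_eq_zero]
    · rfl
    · change p (n + 1) - T (n + 1) = 0
      rw [hT]
      simp only [if_pos (Nat.succ_lt_succ this), sub_self]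
  simp only [h3, sub_zero, zero_add] at h2
  refine h2.congr' ?_ EventuallyEq.rfl
  filter_upwards [hp.analyticAt.eventually_analyticAt] with q hq
  exact fderiv_sub hq.differentiableAt (p.differentiable_partialSum _ q)

theorem tendsto_blowUp (w : ℝ) : Tendsto (fun r : ℝ => (r, r ^ 2 * w)) (𝓝 0) (𝓝 0) := by
  have : ContinuousAt (fun r : ℝ => (r, r ^ 2 * w)) 0 := by fun_prop
  simpa [ContinuousAt, Prod.zero_eq_mk] using this

theorem isBigO_blowUp (w : ℝ) : (fun r : ℝ => (r, r ^ 2 * w)) =O[𝓝 0] fun r : ℝ => r := by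
  refine (isBigO_refl _ _).prod_left ?_
  have : (fun r : ℝ => r * w) =O[𝓝 0] fun _ => (1 : ℝ) :=
    (show ContinuousAt (fun r : ℝ => r * w) 0 by fun_prop).tendsto.isBigO_one ℝ
  refine ((isBigO_refl (fun r : ℝ => r) _).mul this).congr (fun r => ?_) fun r => mul_one _
  ring

/-- Written in the shape (s, 2rws + r²t) required by `fderiv_partialSum_blowUp`, so that s and t are
the velocities of ρ and w. -/
theorem nilpotentField_blowUp (a₁ b₀ b₂ r w : ℝ) :
    nilpotentField a₁ b₀ b₂ (r, r ^ 2 * w) =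
      (r ^ 2 * (w - 1 / 3 + a₁ * r * w),
        2 * r * w * (r ^ 2 * (w - 1 / 3 + a₁ * r * w)) +
          r ^ 2 * (r * (2 - 2 * w ^ 2 + r * (b₀ + (b₂ - 2 * a₁) * w ^ 2)))) := by
  simp only [nilpotentField, Prod.mk.injEq]
  constructor <;> ring

/-- The recursion satisfied by the weighted homogeneous parts (in the blow up) of a first integral
of `nilpotentField a₁ b₀ b₂`. -/
def IsWeightedIntegral (a₁ b₀ b₂ : ℝ) (h : ℕ → ℝ[X]) : Prop :=
  ∀ (k : ℕ) (w : ℝ),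
    (k + 1) * (w - 1 / 3) * (h (k + 1)).eval w +
      (2 - 2 * w ^ 2) * (h (k + 1)).derivative.eval w + k * a₁ * w * (h k).eval w +
        (b₀ + (b₂ - 2 * a₁) * w ^ 2) * (h k).derivative.eval w = 0

theorem HasFPowerSeriesAt.isWeightedIntegral {a₁ b₀ b₂ : ℝ} {H : ℝ × ℝ → ℝ}
    {p : FormalMultilinearSeries ℝ (ℝ × ℝ) ℝ} (hp : HasFPowerSeriesAt H p 0)
    (hH : ∀ᶠ q in 𝓝 0, fderiv ℝ H q (nilpotentField a₁ b₀ b₂ q) = 0) :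
    IsWeightedIntegral a₁ b₀ b₂ p.weightedPart := by
  intro k w
  -- The coefficient of r^(k+2) is needed, so the error O(r^N) must lie beyond it; the parts k and k
  -- + 1 are then unaffected by truncation.
  set N := k + 3 with hN
  set g := p.truncWeightedPart (N + 1) with hg
  set A : ℕ → ℝ := fun l => l * (w - 1 / 3) * (g l).eval w +
    (2 - 2 * w ^ 2) * (g l).derivative.eval w with hA
  set B : ℕ → ℝ := fun l => l * a₁ * w * (g l).eval w +
    (b₀ + (b₂ - 2 * a₁) * w ^ 2) * (g l).derivative.eval w with hB
  set P : ℝ[X] := ∑ l ∈ Finset.range (2 * (N + 1)), (C (A l) * X ^ (l + 1) + C (B l) * X ^ (l + 2))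
    with hP
  have h1 : (fun q => fderiv ℝ (p.partialSum (N + 1)) q (nilpotentField a₁ b₀ b₂ q))
      =O[𝓝 0] fun q => ‖q‖ ^ N := by
    have hF : (fun q => nilpotentField a₁ b₀ b₂ q) =O[𝓝 0] fun _ => (1 : ℝ) := by
      have : Continuous (nilpotentField a₁ b₀ b₂) := by
        unfold nilpotentField; fun_prop
      exact this.continuousAt.tendsto.isBigO_one ℝ
    have h2 : (fun q => (fderiv ℝ H q - fderiv ℝ (p.partialSum (N + 1)) q)
        (nilpotentField a₁ b₀ b₂ q)) =O[𝓝 0] fun q => ‖q‖ ^ N := by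
      refine (IsBigO.of_bound 1 (Eventually.of_forall fun q => ?_)).trans
        (((hp.isBigO_fderiv_sub_fderiv_partialSum N).norm_left.mul hF.norm_left).congr_right
          (g₂ := fun q => ‖q‖ ^ N) fun q => mul_one _)
      rw [one_mul, norm_mul, norm_norm, norm_norm]
      exact ContinuousLinearMap.le_opNorm _ _
    refine h2.neg_left.congr' ?_ EventuallyEq.rfl
    filter_upwards [hH] with q hq
    simp [hq]
  have h4 : (fun r => P.eval r) =O[𝓝 0] fun r : ℝ => r ^ N := by
    refine ((h1.comp_tendsto (tendsto_blowUp w)).trans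
      ((isBigO_blowUp w).norm_left.pow N)).congr_left fun r => ?_
    simp only [Function.comp_apply]
    rw [nilpotentField_blowUp, p.fderiv_partialSum_blowUp, hP, eval_finsetSum]
    refine Finset.sum_congr rfl fun l _ => ?_
    simp only [hA, hB, eval_add, eval_mul, eval_C, eval_pow, eval_X]
    rw [← hg]
    rcases l with _ | l
    · simp; ring
    · simp only [Nat.add_sub_cancel]; ring
  have h5 := Polynomial.coeff_eq_zero_of_isBigO_pow h4 (k := k + 2) (by omega)
  have h6 : P.coeff (k + 2) = A (k + 1) + B k := by
    rw [hP, finsetSum_coeff]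
    simp only [coeff_add, coeff_C_mul, coeff_X_pow]
    rw [Finset.sum_add_distrib, Finset.sum_eq_single (k + 1), Finset.sum_eq_single k]
    · simp
    · intro b _ hb
      simp [hb.symm]
    · intro hk; exact absurd (Finset.mem_range.2 (by omega)) hk
    · intro b _ hb
      rw [if_neg (by omega), mul_zero]
    · intro hk; exact absurd (Finset.mem_range.2 (by omega)) hk
  rw [h6] at h5
  simp only [hA, hB, hg, p.truncWeightedPart_of_lt (show k + 1 < N + 1 by omega),
    p.truncWeightedPart_of_lt (show k < N + 1 by omega)] at h5
  push_cast at h5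
  linarith

theorem HasFPowerSeriesAt.weightedPart_eq_zero_of_isBigO {H : ℝ × ℝ → ℝ}
    {p : FormalMultilinearSeries ℝ (ℝ × ℝ) ℝ} (hp : HasFPowerSeriesAt H p 0) {N : ℕ}
    (hH : H =O[𝓝 0] fun q => ‖q‖ ^ N) {k : ℕ} (hk : k < N) : p.weightedPart k = 0 := by
  have h1 : p.partialSum N =O[𝓝 0] fun q => ‖q‖ ^ N := by
    refine (hH.sub (hp.isBigO_sub_partialSum_pow N)).congr_left fun q => ?_
    simp
  refine Polynomial.funext fun w => ?_
  set P : ℝ[X] := ∑ l ∈ Finset.range (2 * N), C ((p.truncWeightedPart N l).eval w) * X ^ l with hP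
  have h4 : (fun r => P.eval r) =O[𝓝 0] fun r : ℝ => r ^ N := by
    refine ((h1.comp_tendsto (tendsto_blowUp w)).trans
      ((isBigO_blowUp w).norm_left.pow N)).congr_left fun r => ?_
    simp only [Function.comp_apply]
    rw [p.partialSum_blowUp, hP, eval_finsetSum]
    refine Finset.sum_congr rfl fun l _ => ?_
    simp only [eval_mul, eval_C, eval_pow, eval_X]
    ring
  have h5 := Polynomial.coeff_eq_zero_of_isBigO_pow h4 hk
  rw [hP, finsetSum_coeff] at h5
  simp only [coeff_C_mul, coeff_X_pow] at h5
  rw [Finset.sum_eq_single k (fun b _ hb => by simp [hb.symm])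
    (fun hk' => absurd (Finset.mem_range.2 (by omega)) hk'), p.truncWeightedPart_of_lt hk] at h5
  simpa using h5

theorem HasFPowerSeriesAt.eventually_eq_zero_of_weightedPart {H : ℝ × ℝ → ℝ}
    {p : FormalMultilinearSeries ℝ (ℝ × ℝ) ℝ} (hp : HasFPowerSeriesAt H p 0)
    (h : ∀ k, p.weightedPart k = 0) : ∀ᶠ q in 𝓝 0, H q = 0 := by
  filter_upwards [hp.eventually_hasSum] with q hq
  rw [zero_add] at hq
  refine hq.unique ?_
  have : ∀ n, p n (fun _ => q) = 0 := by
    intro n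
    refine (p.apply_diag_eq_sum_planarCoeff n q.1 q.2).trans (Finset.sum_eq_zero fun i hi => ?_)
    rw [← p.coeff_weightedPart (by have := Finset.mem_range.1 hi; omega), h, Polynomial.coeff_zero, zero_mul]
  simp only [this]
  exact hasSum_zero

/-! ### The leading operator and its behaviour at w = ±1. -/

/-- The zeros of 2 - 2X² at ±1 restore the factors lost by differentiation. -/
theorem Polynomial.mul_derivative_X_sub_one_pow_mul_X_add_one_pow (t r : ℕ) (q : ℝ[X]) :
    (2 - 2 * X ^ 2) * derivative ((X - 1) ^ t * (X + 1) ^ r * q) =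
      (X - 1) ^ t * (X + 1) ^ r *
        ((C (-2 * (t : ℝ)) * (X + 1) + C (-2 * (r : ℝ)) * (X - 1)) * q +
          (2 - 2 * X ^ 2) * derivative q) := by
  have hu : (X - 1) * derivative ((X - 1 : ℝ[X]) ^ t) = C (t : ℝ) * (X - 1) ^ t := by
    rcases t with _ | t
    · simp
    · simp [derivative_pow]; ring
  have hv : (X + 1) * derivative ((X + 1 : ℝ[X]) ^ r) = C (r : ℝ) * (X + 1) ^ r := by
    rcases r with _ | r
    · simp
    · simp [derivative_pow]; ring
  simp only [derivative_mul, C_mul, C_neg, C_ofNat]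
  linear_combination (-2 * (X + 1) * (X + 1) ^ r * q) * hu - 2 * (X - 1) * (X - 1) ^ t * q * hv

/-- The part of the recursion for first integrals which comes from the leading weighted homogeneous
terms of the vector field. -/
noncomputable def weightedLieDeriv (k : ℕ) (h : ℝ[X]) : ℝ[X] :=
  C (k : ℝ) * (X - C (1 / 3)) * h + (2 - 2 * X ^ 2) * derivative h

theorem weightedLieDeriv_mul (k t r : ℕ) (q : ℝ[X]) :
    weightedLieDeriv k ((X - 1) ^ t * (X + 1) ^ r * q) =
      (X - 1) ^ t * (X + 1) ^ r *
        (C (k : ℝ) * (X - C (1 / 3)) * q +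
          ((C (-2 * (t : ℝ)) * (X + 1) + C (-2 * (r : ℝ)) * (X - 1)) * q +
            (2 - 2 * X ^ 2) * derivative q)) := by
  rw [weightedLieDeriv, mul_derivative_X_sub_one_pow_mul_X_add_one_pow]
  ring

theorem X_sub_one_ne_zero_real : (X - 1 : ℝ[X]) ≠ 0 := by
  simpa using X_sub_C_ne_zero (1 : ℝ)

theorem X_add_one_ne_zero_real : (X + 1 : ℝ[X]) ≠ 0 := by
  simpa using X_add_C_ne_zero (1 : ℝ)

/-- Indicial equation at 1: applied to (X-1)^t g, the operator gives (X-1)^t times a polynomial with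
value (2/3)(k - 6t)g(1) at 1. Without resonance g(1) = 0, which gains one factor at a time. -/
theorem X_sub_one_pow_dvd_of_weightedLieDeriv {k e : ℕ} {h : ℝ[X]}
    (hR : (X - 1) ^ e ∣ weightedLieDeriv k h) (hk : ∀ t < e, k ≠ 6 * t) : (X - 1) ^ e ∣ h := by
  suffices H : ∀ t ≤ e, (X - 1) ^ t ∣ h from H e le_rfl
  intro t
  induction t with
  | zero => simp
  | succ t ih =>
    intro ht
    obtain ⟨g, hg⟩ := ih (by omega)
    obtain ⟨S, hS⟩ := hR
    have h1 := weightedLieDeriv_mul k t 0 g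
    rw [pow_zero, mul_one, ← hg, hS, show e = t + ((e - t - 1) + 1) by omega, pow_add,
      mul_assoc] at h1
    have h2 := congrArg (eval 1) (mul_left_cancel₀ (pow_ne_zero t X_sub_one_ne_zero_real) h1)
    have h3 : (X - 1) ∣ g := by
      rw [← C_1, dvd_iff_isRoot, IsRoot.def]
      have h4 : ((k : ℝ) - 6 * t) * eval 1 g = 0 := by
        simp [pow_succ] at h2
        linarith
      refine (mul_eq_zero.1 h4).resolve_left fun h5 => hk t (by omega) ?_
      exact_mod_cast sub_eq_zero.1 h5
    rw [hg, pow_succ]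
    exact mul_dvd_mul_left _ h3

/-- The same argument at -1, where the indicial factor is -(4/3)(k - 3t). -/
theorem X_add_one_pow_dvd_of_weightedLieDeriv {k e : ℕ} {h : ℝ[X]}
    (hR : (X + 1) ^ e ∣ weightedLieDeriv k h) (hk : ∀ t < e, k ≠ 3 * t) : (X + 1) ^ e ∣ h := by
  suffices H : ∀ t ≤ e, (X + 1) ^ t ∣ h from H e le_rfl
  intro t
  induction t with
  | zero => simp
  | succ t ih =>
    intro ht
    obtain ⟨g, hg⟩ := ih (by omega)
    obtain ⟨S, hS⟩ := hR
    have h1 := weightedLieDeriv_mul k 0 t g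
    rw [pow_zero, one_mul, ← hg, hS, show e = t + ((e - t - 1) + 1) by omega, pow_add,
      mul_assoc] at h1
    have h2 := congrArg (eval (-1)) (mul_left_cancel₀ (pow_ne_zero t X_add_one_ne_zero_real) h1)
    have h3 : (X + 1) ∣ g := by
      have : (X + 1 : ℝ[X]) = X - C (-1) := by simp
      rw [this, dvd_iff_isRoot, IsRoot.def]
      have h4 : ((k : ℝ) - 3 * t) * eval (-1) g = 0 := by
        simp [pow_succ] at h2
        linarith
      refine (mul_eq_zero.1 h4).resolve_left fun h5 => hk t (by omega) ?_
      exact_mod_cast sub_eq_zero.1 h5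
    rw [hg, pow_succ]
    exact mul_dvd_mul_left _ h3

theorem exists_eq_of_weightedLieDeriv_dvd {k t r : ℕ} {h : ℝ[X]}
    (hR : (X - 1) ^ t * (X + 1) ^ r ∣ weightedLieDeriv k h) (ht : 6 * t ≤ k) (hr : 3 * r ≤ k) :
    ∃ q, h = (X - 1) ^ t * (X + 1) ^ r * q := by
  have hc : IsCoprime (X - 1 : ℝ[X]) (X + 1) := by
    refine ⟨C (-1 / 2), C (1 / 2), ?_⟩
    have : C (1 / 2 : ℝ) * 2 = 1 := by
      rw [← C_ofNat, ← C_mul]; norm_num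
    rw [neg_div, C_neg]
    linear_combination this
  exact (hc.pow (m := t) (n := r)).mul_dvd
    (X_sub_one_pow_dvd_of_weightedLieDeriv ((dvd_mul_right _ _).trans hR) fun s hs => by omega)
    (X_add_one_pow_dvd_of_weightedLieDeriv ((dvd_mul_left _ _).trans hR) fun s hs => by omega)

/-- The exact multiplicities t at 1 and r at -1 solve the indicial equations k = 6t = 3r. The
cofactor g then satisfies (2 - 2X²)g' = 0, hence is constant. -/
theorem exists_eq_of_weightedLieDeriv_eq_zero {k : ℕ} {h : ℝ[X]} (h0 : h ≠ 0)
    (hk : weightedLieDeriv k h = 0) :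
    ∃ j : ℕ, k = 6 * j ∧ ∃ c : ℝ, c ≠ 0 ∧ h = (X - 1) ^ j * (X + 1) ^ (2 * j) * C c := by
  obtain ⟨f, hf, hf1⟩ := h.exists_eq_pow_rootMultiplicity_mul_and_not_dvd h0 1
  set t := h.rootMultiplicity 1
  have hf0 : f ≠ 0 := by rintro rfl; simp at hf1
  obtain ⟨g, hg, hg1⟩ := f.exists_eq_pow_rootMultiplicity_mul_and_not_dvd hf0 (-1)
  set r := f.rootMultiplicity (-1)
  have hh : h = (X - 1) ^ t * (X + 1) ^ r * g := by
    rw [hf, hg]; simp [mul_assoc]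
  have hgm : g.eval (-1) ≠ 0 := fun h1 => hg1 (dvd_iff_isRoot.2 h1)
  have hgp : g.eval 1 ≠ 0 := by
    intro h1
    refine hf1 ?_
    rw [hg]
    exact (dvd_iff_isRoot.2 h1).mul_left _
  have h1 := weightedLieDeriv_mul k t r g
  rw [← hh, hk] at h1
  have h2 := (mul_eq_zero.1 h1.symm).resolve_left (mul_ne_zero
    (pow_ne_zero _ X_sub_one_ne_zero_real) (pow_ne_zero _ X_add_one_ne_zero_real))
  have h3 : ((k : ℝ) - 6 * t) * g.eval 1 = 0 := by
    have := congrArg (eval 1) h2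
    simp at this
    linarith
  have h4 : ((k : ℝ) - 3 * r) * g.eval (-1) = 0 := by
    have := congrArg (eval (-1)) h2
    simp at this
    linarith
  have h5 : (k : ℝ) = 6 * t := sub_eq_zero.1 ((mul_eq_zero.1 h3).resolve_right hgp)
  have h6 : (k : ℝ) = 3 * r := sub_eq_zero.1 ((mul_eq_zero.1 h4).resolve_right hgm)
  have h7 : k = 6 * t := by exact_mod_cast h5
  have h8 : k = 3 * r := by exact_mod_cast h6
  have h9 : r = 2 * t := by omega
  have h10 : (2 - 2 * X ^ 2) * derivative g = 0 := by
    have h11 : (r : ℝ) = 2 * t := by exact_mod_cast h9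
    have h13 : C (1 / 3 : ℝ) * 3 = 1 := by
      rw [← C_ofNat, ← C_mul]; norm_num
    rw [h5, h11] at h2
    simp only [C_mul, C_neg, C_ofNat] at h2
    linear_combination h2 + 2 * C (t : ℝ) * g * h13
  have h12 : derivative g = 0 := by
    refine (mul_eq_zero.1 h10).resolve_left fun h => ?_
    have := congrArg (eval 0) h
    simp at this
  refine ⟨t, h7, g.coeff 0, ?_, ?_⟩
  · intro hc
    rw [eq_C_of_natDegree_eq_zero (derivative_eq_zero.1 h12), hc] at hgp
    simp at hgp
  · rw [← eq_C_of_natDegree_eq_zero (derivative_eq_zero.1 h12), ← h9, ← hh]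

/-! ### Descent of the factors X - 1 and X + 1 along the recursion. -/

namespace IsWeightedIntegral

variable {a₁ b₀ b₂ : ℝ} {h : ℕ → ℝ[X]}

theorem weightedLieDeriv_succ (hh : IsWeightedIntegral a₁ b₀ b₂ h) (k : ℕ) :
    weightedLieDeriv (k + 1) (h (k + 1)) =
      -(C (k * a₁) * X * h k + (C b₀ + C (b₂ - 2 * a₁) * X ^ 2) * derivative (h k)) := by
  refine Polynomial.funext fun w => ?_
  have := hh k w
  simp only [weightedLieDeriv, eval_add, eval_mul, eval_sub, eval_neg, eval_pow, eval_X, eval_C,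
    eval_ofNat]
  push_cast
  linarith

theorem const_mul (hh : IsWeightedIntegral a₁ b₀ b₂ h) (c : ℝ) :
    IsWeightedIntegral a₁ b₀ b₂ fun k => C c * h k := by
  intro k w
  simp only [eval_mul, eval_C, derivative_C_mul]
  linear_combination c * hh k w

/-- One step of the recursion, after division by the expected powers of `X - 1` and `X + 1`. -/
theorem exists_succ_eq (hh : IsWeightedIntegral a₁ b₀ b₂ h) {k t r : ℕ} {q : ℝ[X]}
    (hk : h k = (X - 1) ^ (t + 1) * (X + 1) ^ (r + 1) * q) (ht : 6 * t ≤ k + 1)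
    (hr : 3 * r ≤ k + 1) {n : ℕ} (hdeg : (h (k + 1)).natDegree ≤ t + r + n) :
    ∃ s : ℝ[X], h (k + 1) = (X - 1) ^ t * (X + 1) ^ r * s ∧ s.natDegree ≤ n ∧
      ∀ w : ℝ, ((k + 1) * (w - 1 / 3) - 2 * t * (w + 1) - 2 * r * (w - 1)) * s.eval w +
        (2 - 2 * w ^ 2) * s.derivative.eval w + k * a₁ * w * (w ^ 2 - 1) * q.eval w +
        (b₀ + (b₂ - 2 * a₁) * w ^ 2) * (((t + 1) * (w + 1) + (r + 1) * (w - 1)) * q.eval w +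
          (w ^ 2 - 1) * q.derivative.eval w) = 0 := by
  have hd : derivative (h k) = (X - 1) ^ t * (X + 1) ^ r *
      ((C ((t : ℝ) + 1) * (X + 1) + C ((r : ℝ) + 1) * (X - 1)) * q +
        (X ^ 2 - 1) * derivative q) := by
    rw [hk]
    simp only [derivative_mul, derivative_pow, derivative_sub, derivative_add, derivative_X,
      derivative_one, Nat.add_sub_cancel]
    push_cast
    ring
  have hR : weightedLieDeriv (k + 1) (h (k + 1)) = (X - 1) ^ t * (X + 1) ^ r *
      -(C (k * a₁) * X * (X ^ 2 - 1) * q + (C b₀ + C (b₂ - 2 * a₁) * X ^ 2) *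
        ((C ((t : ℝ) + 1) * (X + 1) + C ((r : ℝ) + 1) * (X - 1)) * q +
          (X ^ 2 - 1) * derivative q)) := by
    rw [hh.weightedLieDeriv_succ, hd, hk]
    ring
  obtain ⟨s, hs⟩ := exists_eq_of_weightedLieDeriv_dvd ⟨_, hR⟩ ht hr
  have hne : (X - 1 : ℝ[X]) ^ t * (X + 1) ^ r ≠ 0 := mul_ne_zero
    (pow_ne_zero _ X_sub_one_ne_zero_real) (pow_ne_zero _ X_add_one_ne_zero_real)
  refine ⟨s, hs, ?_, fun w => ?_⟩
  · rcases eq_or_ne s 0 with rfl | h0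
    · simp
    have h1 : ((X - 1 : ℝ[X]) ^ t * (X + 1) ^ r).natDegree = t + r := by
      have hu : (X - 1 : ℝ[X]).natDegree = 1 := by simpa using natDegree_X_sub_C (1 : ℝ)
      have hv : (X + 1 : ℝ[X]).natDegree = 1 := by simpa using natDegree_X_add_C (1 : ℝ)
      rw [natDegree_mul (pow_ne_zero _ X_sub_one_ne_zero_real)
        (pow_ne_zero _ X_add_one_ne_zero_real), natDegree_pow, natDegree_pow, hu, hv]
      simp
    rw [hs, natDegree_mul hne h0, h1] at hdeg
    omega
  · rw [hs, weightedLieDeriv_mul] at hR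
    have h1 := congrArg (eval w) (mul_left_cancel₀ hne hR)
    simp only [eval_add, eval_mul, eval_sub, eval_neg, eval_pow, eval_X, eval_C, eval_ofNat,
      eval_one] at h1
    push_cast at h1
    linarith

end IsWeightedIntegral

/-! ### The linear systems at orders one, two and three. -/

theorem Polynomial.eval_eq_sum_range_of_natDegree_le {q : ℝ[X]} {n : ℕ} (hq : q.natDegree ≤ n)
    (w : ℝ) : q.eval w = ∑ i ∈ Finset.range (n + 1), q.coeff i * w ^ i :=
  eval_eq_sum_range' (Nat.lt_succ_of_le hq) w

theorem Polynomial.eval_derivative_eq_sum_range_of_natDegree_le {q : ℝ[X]} {n : ℕ}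
    (hq : q.natDegree ≤ n + 1) (w : ℝ) :
    q.derivative.eval w = ∑ i ∈ Finset.range (n + 1), q.coeff (i + 1) * (i + 1) * w ^ i := by
  rw [eval_eq_sum_range' (n := n + 1) (by have := natDegree_derivative_le q; omega)]
  simp only [coeff_derivative]

/-- The obstruction at the first order. -/
theorem first_obstruction {a₁ b₀ b₂ j : ℝ} {s : ℝ[X]} (hj : j ≠ 0) (hs : s.natDegree ≤ 2)
    (E : ∀ w : ℝ, (5 * w - 1 / 3) * s.eval w + (2 - 2 * w ^ 2) * s.derivative.eval w +
      6 * j * a₁ * w * (w ^ 2 - 1) + (b₀ + (b₂ - 2 * a₁) * w ^ 2) * (j * (3 * w - 1)) = 0) :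
    27 * (b₀ + b₂) + 58 * a₁ = 0 := by
  simp only [eval_eq_sum_range_of_natDegree_le hs,
    eval_derivative_eq_sum_range_of_natDegree_le hs, Finset.sum_range_succ,
    Finset.sum_range_zero] at E
  have e0 := E 0
  have e1 := E 1
  have em1 := E (-1)
  have e2 := E 2
  norm_num at e0 e1 em1 e2
  refine (mul_eq_zero.1 (?_ : j * _ = 0)).resolve_left hj
  -- A cubic identity in three unknown coefficients: these weights on its values at 0, 1, -1, 2
  -- eliminate all three.
  linear_combination (-1680 / 36) * e0 + (24 / 36) * e1 + (329 / 36) * em1 + (112 / 36) * e2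

/-- The solution of the recursion at the first order. -/
theorem first_order_solution {α β j : ℝ} {s : ℝ[X]} (hs : s.natDegree ≤ 2)
    (E : ∀ w : ℝ, (5 * w - 1 / 3) * s.eval w + (2 - 2 * w ^ 2) * s.derivative.eval w +
      6 * j * (27 * α) * w * (w ^ 2 - 1) +
      ((-29 * α - β) + ((-29 * α + β) - 2 * (27 * α)) * w ^ 2) * (j * (3 * w - 1)) = 0) :
    s.coeff 0 =
      -21 * j * α + 3 * j * β ∧
    s.coeff 1 =
      -18 * j * α ∧
    s.coeff 2 =
      87 * j * α - 3 * j * β := by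
  simp only [eval_eq_sum_range_of_natDegree_le hs,
    eval_derivative_eq_sum_range_of_natDegree_le hs, Finset.sum_range_succ,
    Finset.sum_range_zero] at E
  have e0 := E 0
  have e1 := E 1
  have em1 := E (-1)
  norm_num at e0 e1 em1
  -- The weights are the rows of the inverse of the 3 × 3 matrix of the evaluated system.
  refine ⟨?_, ?_, ?_⟩
  · linear_combination
      (-3) * e0 + (9/14) * e1 + (9/16) * em1
  · linear_combination
      (3/28) * e1 + (3/32) * em1
  · linear_combination
      (3) * e0 + (-15/28) * e1 + (-21/32) * em1

/-- The solution of the recursion at the second order. -/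
theorem second_order_solution {α β j : ℝ} {s : ℝ[X]} (hs : s.natDegree ≤ 5)
    (E : ∀ w : ℝ, 2 * (5 * w - 1 / 3) * s.eval w + (2 - 2 * w ^ 2) * s.derivative.eval w +
      (6 * j + 1) * (27 * α) * w * (w ^ 2 - 1) *
        ((-21 * j * α + 3 * j * β) + (-18 * j * α) * w +
          (87 * j * α - 3 * j * β) * w ^ 2) +
      ((-29 * α - β) + ((-29 * α + β) - 2 * (27 * α)) * w ^ 2) *
        ((j * (3 * w - 1) - 2 * w) *
          ((-21 * j * α + 3 * j * β) + (-18 * j * α) * w +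
            (87 * j * α - 3 * j * β) * w ^ 2) +
          (w ^ 2 - 1) * ((-18 * j * α) + 2 * (87 * j * α - 3 * j * β) * w)) = 0) :
    s.coeff 0 =
      441 / 2 * j ^ 2 * α ^ 2 - 63 * j ^ 2 * α * β + 9 / 2 * j ^ 2 * β ^ 2 -
      8343 / 16 * j * α ^ 2 + 1863 / 80 * j * α * β ∧
    s.coeff 1 =
      378 * j ^ 2 * α ^ 2 - 54 * j ^ 2 * α * β + 1395 / 16 * j * α ^ 2 + 1341 / 80 * j * α * β ∧
    s.coeff 2 =
      -1665 * j ^ 2 * α ^ 2 + 324 * j ^ 2 * α * β - 9 * j ^ 2 * β ^ 2 + 1755 / 8 * j * α ^ 2 -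
      2727 / 40 * j * α * β ∧
    s.coeff 3 =
      -1566 * j ^ 2 * α ^ 2 + 54 * j ^ 2 * α * β + 1305 / 8 * j * α ^ 2 - 1197 / 40 * j * α * β ∧
    s.coeff 4 =
      7569 / 2 * j ^ 2 * α ^ 2 - 261 * j ^ 2 * α * β + 9 / 2 * j ^ 2 * β ^ 2 -
      18495 / 16 * j * α ^ 2 + 3591 / 80 * j * α * β ∧
    s.coeff 5 =
      891 / 16 * j * α ^ 2 + 1053 / 80 * j * α * β := by
  simp only [eval_eq_sum_range_of_natDegree_le hs,
    eval_derivative_eq_sum_range_of_natDegree_le hs, Finset.sum_range_succ,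
    Finset.sum_range_zero] at E
  have e0 := E 0
  have e1 := E 1
  have em1 := E (-1)
  have e2 := E 2
  have em2 := E (-2)
  have e3 := E 3
  norm_num at e0 e1 em1 e2 em2 e3
  refine ⟨?_, ?_, ?_, ?_, ?_, ?_⟩
  · linear_combination
      (81/1280) * e0 + (2853/17920) * e1 + (-9/160) * em1 + (-153/2560) * e2 + (99/12800) * em2 +
      (237/25600) * e3
  · linear_combination
      (667/1280) * e0 + (951/17920) * e1 + (-3/160) * em1 + (-51/2560) * e2 + (33/12800) * em2 +
      (79/25600) * e3
  · linear_combination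
      (-99/640) * e0 + (-1247/8960) * e1 + (1/80) * em1 + (107/1280) * e2 + (-41/6400) * em2 +
      (-183/12800) * e3
  · linear_combination
      (-589/640) * e0 + (223/8960) * e1 + (11/80) * em1 + (37/1280) * e2 + (-71/6400) * em2 +
      (-73/12800) * e3
  · linear_combination
      (117/1280) * e0 + (601/17920) * e1 + (-1/320) * em1 + (-61/2560) * e2 + (-17/12800) * em2 +
      (129/25600) * e3
  · linear_combination
      (511/1280) * e0 + (-437/17920) * e1 + (-23/320) * em1 + (-23/2560) * e2 +
      (109/12800) * em2 + (67/25600) * e3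

/-- The obstruction at the third order. -/
theorem third_obstruction {α β j : ℝ} {s : ℝ[X]} {c : ℕ → ℝ} (hj : j ≠ 0) (hs : s.natDegree ≤ 7)
    (hc : c 0 =
      441 / 2 * j ^ 2 * α ^ 2 - 63 * j ^ 2 * α * β + 9 / 2 * j ^ 2 * β ^ 2 -
      8343 / 16 * j * α ^ 2 + 1863 / 80 * j * α * β ∧
    c 1 =
      378 * j ^ 2 * α ^ 2 - 54 * j ^ 2 * α * β + 1395 / 16 * j * α ^ 2 + 1341 / 80 * j * α * β ∧
    c 2 =
      -1665 * j ^ 2 * α ^ 2 + 324 * j ^ 2 * α * β - 9 * j ^ 2 * β ^ 2 + 1755 / 8 * j * α ^ 2 -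
      2727 / 40 * j * α * β ∧
    c 3 =
      -1566 * j ^ 2 * α ^ 2 + 54 * j ^ 2 * α * β + 1305 / 8 * j * α ^ 2 - 1197 / 40 * j * α * β ∧
    c 4 =
      7569 / 2 * j ^ 2 * α ^ 2 - 261 * j ^ 2 * α * β + 9 / 2 * j ^ 2 * β ^ 2 -
      18495 / 16 * j * α ^ 2 + 3591 / 80 * j * α * β ∧
    c 5 =
      891 / 16 * j * α ^ 2 + 1053 / 80 * j * α * β)
    (E : ∀ w : ℝ, 3 * (5 * w - 1 / 3) * s.eval w + (2 - 2 * w ^ 2) * s.derivative.eval w +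
      (6 * j + 2) * (27 * α) * w * (w ^ 2 - 1) *
        (∑ i ∈ Finset.range 6, c i * w ^ i) +
      ((-29 * α - β) + ((-29 * α + β) - 2 * (27 * α)) * w ^ 2) *
        ((j * (3 * w - 1) - 4 * w) * (∑ i ∈ Finset.range 6, c i * w ^ i) +
          (w ^ 2 - 1) * (∑ i ∈ Finset.range 5, c (i + 1) * (i + 1) * w ^ i)) = 0) :
    α * (43 * (4 * β) ^ 2 - 2766 * (4 * β) * α + 79640 * α ^ 2) = 0 := by
  obtain ⟨h0, h1, h2, h3, h4, h5⟩ := hc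
  simp only [eval_eq_sum_range_of_natDegree_le hs,
    eval_derivative_eq_sum_range_of_natDegree_le hs, Finset.sum_range_succ,
    Finset.sum_range_zero, Nat.reduceAdd, h0, h1, h2, h3, h4, h5] at E
  have e0 := E 0
  have e1 := E 1
  have em1 := E (-1)
  have e2 := E 2
  have em2 := E (-2)
  have e3 := E 3
  have em3 := E (-3)
  have e4 := E 4
  have em4 := E (-4)
  norm_num at e0 e1 em1 e2 em2 e3 em3 e4 em4
  -- Nine values of an identity of degree 8 eliminate the eight coefficients of s. The j² and j³
  -- terms cancel, so the obstruction does not depend on j.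
  refine (mul_eq_zero.1 (?_ : j * _ = 0)).resolve_left hj
  linear_combination
    (2574040 / 181440) * e0 + (-187712 / 181440) * e1 + (-466683 / 181440) * em1 +
    (12432 / 181440) * e2 + (112336 / 181440) * em2 + (1324 / 181440) * e3 +
    (-20192 / 181440) * em3 + (-332 / 181440) * e4 + (1812 / 181440) * em4

/-! ### From the obstructions to the parameters. -/

theorem IsWeightedIntegral.params_of_leading {a₁ b₀ b₂ : ℝ} {h : ℕ → ℝ[X]}
    (hh : IsWeightedIntegral a₁ b₀ b₂ h) (hdeg : ∀ k, (h k).natDegree ≤ k / 2) {J : ℕ}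
    (h0 : h (6 * J + 18) = (X - 1) ^ (J + 3) * (X + 1) ^ (2 * J + 6)) :
    a₁ = 0 ∧ b₀ + b₂ = 0 := by
  -- Here j = J + 3 is the exponent of X - 1 in the leading part; using J keeps the lowered
  -- exponents natural numbers.
  obtain ⟨j, hj⟩ : ∃ j : ℝ, (J : ℝ) = j - 3 := ⟨J + 3, by ring⟩
  have hj0 : j ≠ 0 := by
    have : (0 : ℝ) ≤ J := Nat.cast_nonneg J
    intro h; linarith
  obtain ⟨q₁, hq₁, hd₁, E₁⟩ := hh.exists_succ_eq (k := 6 * J + 18) (t := J + 2) (r := 2 * J + 5)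
    (q := 1) (by rw [h0, mul_one]) (by omega) (by omega) (n := 2)
    ((hdeg _).trans (by omega))
  obtain ⟨q₂, hq₂, hd₂, E₂⟩ := hh.exists_succ_eq (k := 6 * J + 19) (t := J + 1) (r := 2 * J + 4)
    (q := q₁) hq₁ (by omega) (by omega) (n := 5) ((hdeg _).trans (by omega))
  obtain ⟨q₃, -, hd₃, E₃⟩ := hh.exists_succ_eq (k := 6 * J + 20) (t := J) (r := 2 * J + 3)
    (q := q₂) hq₂ (by omega) (by omega) (n := 7) ((hdeg _).trans (by omega))
  push_cast at E₁ E₂ E₃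
  simp only [hj] at E₁ E₂ E₃
  have hab : 27 * (b₀ + b₂) + 58 * a₁ = 0 := by
    refine first_obstruction hj0 hd₁ fun w => ?_
    have := E₁ w
    simp only [eval_one, derivative_one, eval_zero] at this
    linear_combination this
  -- α and β parametrise the plane cut out by the first obstruction.
  obtain ⟨α, rfl⟩ : ∃ α, a₁ = 27 * α := ⟨a₁ / 27, by ring⟩
  obtain ⟨β, rfl⟩ : ∃ β, b₀ = -29 * α - β := ⟨-29 * α - b₀, by ring⟩
  obtain rfl : b₂ = -29 * α + β := by linarith
  have hα : α * (43 * (4 * β) ^ 2 - 2766 * (4 * β) * α + 79640 * α ^ 2) = 0 := by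
    obtain ⟨c0, c1, c2⟩ := first_order_solution (α := α) (β := β) (j := j) hd₁ fun w => by
      have := E₁ w
      simp only [eval_one, derivative_one, eval_zero] at this
      linear_combination this
    have hd := second_order_solution (α := α) (β := β) (j := j) hd₂ fun w => by
      have := E₂ w
      simp only [eval_eq_sum_range_of_natDegree_le hd₁,
        eval_derivative_eq_sum_range_of_natDegree_le hd₁, Finset.sum_range_succ,
        Finset.sum_range_zero, Nat.reduceAdd, c0, c1, c2] at this
      push_cast at this
      linear_combination this
    refine third_obstruction hj0 hd₃ hd fun w => ?_
    have := E₃ w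
    rw [eval_eq_sum_range_of_natDegree_le hd₂,
      eval_derivative_eq_sum_range_of_natDegree_le hd₂] at this
    linear_combination this
  have hα0 : α = 0 := by
    by_contra hne
    have h1 := (mul_eq_zero.1 hα).resolve_left hne
    have h2 : 0 < α ^ 2 := by positivity
    -- Completing the square: 43 times the form is this square plus (43·79640 - 1383²)α², and that
    -- coefficient is positive.
    nlinarith [sq_nonneg (43 * (4 * β) - 1383 * α)]
  subst hα0
  constructor <;> ring

theorem IsWeightedIntegral.params {a₁ b₀ b₂ : ℝ} {h : ℕ → ℝ[X]}
    (hh : IsWeightedIntegral a₁ b₀ b₂ h) (hdeg : ∀ k, (h k).natDegree ≤ k / 2)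
    (hlow : ∀ k < 18, h k = 0) (hne : ∃ k, h k ≠ 0) : a₁ = 0 ∧ b₀ + b₂ = 0 := by
  classical
  obtain ⟨hm, hmin⟩ := And.intro (Nat.find_spec hne) fun k => Nat.find_min hne (m := k)
  set m := Nat.find hne
  have hm18 : 18 ≤ m := by
    by_contra! hlt
    exact hm (hlow m hlt)
  have hz : weightedLieDeriv m (h m) = 0 := by
    have h1 := hh.weightedLieDeriv_succ (m - 1)
    rw [not_not.1 (hmin (m - 1) (by omega)), Nat.sub_add_cancel (by omega)] at h1
    simpa using h1
  obtain ⟨j, hj, c, hc, hmj⟩ := exists_eq_of_weightedLieDeriv_eq_zero hm hz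
  obtain ⟨J, rfl⟩ : ∃ J, j = J + 3 := ⟨j - 3, by omega⟩
  refine (hh.const_mul c⁻¹).params_of_leading (J := J)
    (fun k => (natDegree_C_mul_le _ _).trans (hdeg k)) ?_
  rw [show 6 * J + 18 = m by omega, hmj, show 2 * (J + 3) = 2 * J + 6 by ring, mul_comm, mul_assoc,
    ← C_mul, mul_inv_cancel₀ hc, C_1, mul_one]

/-! ### Necessity for an arbitrary analytic first integral. -/

theorem params_of_isAnalyticallyIntegrableAt {a₁ b₀ b₂ : ℝ}
    (hI : IsAnalyticallyIntegrableAt (nilpotentField a₁ b₀ b₂) (0, 0)) :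
    a₁ = 0 ∧ b₀ + b₂ = 0 := by
  obtain ⟨U, hU, h0U, H, hH⟩ := hI
  have hU0 : U ∈ 𝓝 (0 : ℝ × ℝ) := hU.mem_nhds h0U
  have hHa : AnalyticAt ℝ H 0 := hH.analytic 0 h0U
  -- The power is again annihilated by the field and vanishes to order 18 = 6·3, so its leading
  -- weight 6j has j ≥ 3.
  set G : ℝ × ℝ → ℝ := fun q => (H q - H 0) ^ 18 with hG
  have hGa : AnalyticAt ℝ G 0 := (hHa.sub analyticAt_const).pow 18
  obtain ⟨p, hp⟩ := hGa
  have hGL : ∀ᶠ q in 𝓝 0, fderiv ℝ G q (nilpotentField a₁ b₀ b₂ q) = 0 := by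
    filter_upwards [hU0] with q hq
    have h1 := (((hH.analytic q hq).differentiableAt.hasFDerivAt.sub_const (H 0)).pow 18).fderiv
    rw [h1]
    simp [hH.lieDeriv_eq_zero q hq]
  have hGO : G =O[𝓝 0] fun q => ‖q‖ ^ 18 := by
    have h1 : (fun q => H q - H 0) =O[𝓝 0] fun q => ‖q‖ := by
      simpa using hHa.differentiableAt.isBigO_sub.norm_right
    exact h1.pow 18
  refine (hp.isWeightedIntegral hGL).params p.natDegree_weightedPart_le
    (fun k hk => hp.weightedPart_eq_zero_of_isBigO hGO hk) ?_
  by_contra! hall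
  obtain ⟨V, hVU, hV, h0V⟩ := mem_nhds_iff.1
    (inter_mem hU0 (hp.eventually_eq_zero_of_weightedPart hall))
  refine hH.nonconstant V (fun q hq => (hVU hq).1) hV ⟨0, h0V⟩ ⟨H 0, fun q hq => ?_⟩
  exact sub_eq_zero.1 (pow_eq_zero_iff (by norm_num) |>.1 (hVU hq).2)

/-! ### Sufficiency: the explicit integral. -/

theorem isAnalyticFirstIntegralOn_univ (b₂ : ℝ) :
    IsAnalyticFirstIntegralOn (nilpotentField 0 (-b₂) b₂) Set.univ
      (fun p : ℝ × ℝ => (p.2 - p.1 ^ 2) * (p.2 + p.1 ^ 2) ^ 2 * Real.exp (-3 * b₂ * p.1)) := by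
  have hA : AnalyticOnNhd ℝ (fun p : ℝ × ℝ =>
      (p.2 - p.1 ^ 2) * (p.2 + p.1 ^ 2) ^ 2 * Real.exp (-3 * b₂ * p.1)) Set.univ := by
    intro p _
    have h1 : AnalyticAt ℝ (fun q : ℝ × ℝ => q.1) p := analyticAt_fst
    have h2 : AnalyticAt ℝ (fun q : ℝ × ℝ => q.2) p := analyticAt_snd
    exact ((h2.fun_sub (h1.fun_pow 2)).fun_mul ((h2.fun_add (h1.fun_pow 2)).fun_pow 2)).fun_mul
      (analyticAt_const.fun_mul h1).rexp
  refine ⟨hA, fun p _ => ?_, ?_⟩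
  · have h1 : HasFDerivAt (fun q : ℝ × ℝ => q.1) (ContinuousLinearMap.fst ℝ ℝ ℝ) p :=
      hasFDerivAt_fst
    have h2 : HasFDerivAt (fun q : ℝ × ℝ => q.2) (ContinuousLinearMap.snd ℝ ℝ ℝ) p :=
      hasFDerivAt_snd
    have h3 := ((h2.fun_sub (h1.pow 2)).fun_mul ((h2.fun_add (h1.pow 2)).pow 2)).fun_mul
      (h1.const_mul (-3 * b₂)).exp
    rw [h3.fderiv]
    simp [nilpotentField]
    ring
  · rintro V - hV ⟨x, hx⟩ ⟨c, hc⟩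
    -- By the identity theorem, local constancy would be global, but the values at (0, 0) and (0, 1)
    -- are 0 and 1.
    have h1 := hA.eq_of_eventuallyEq (g := fun _ => c) analyticOnNhd_const (z₀ := x)
      (eventually_of_mem (hV.mem_nhds hx) hc)
    have h2 := congrFun h1 (0, 0)
    have h3 := congrFun h1 (0, 1)
    norm_num at h2 h3
    linarith

theorem mainTheorem12 (a₁ b₀ b₂ : ℝ) :
    (IsAnalyticallyIntegrableAt (nilpotentField a₁ b₀ b₂) (0, 0) ↔ a₁ = 0 ∧ b₀ + b₂ = 0) ∧
    (a₁ = 0 ∧ b₀ + b₂ = 0 →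
      IsAnalyticFirstIntegralOn (nilpotentField a₁ b₀ b₂) Set.univ
        (fun p : ℝ × ℝ =>
          (p.2 - p.1 ^ 2) * (p.2 + p.1 ^ 2) ^ 2 * Real.exp (-3 * b₂ * p.1))) := by
  have h : a₁ = 0 ∧ b₀ + b₂ = 0 →
      IsAnalyticFirstIntegralOn (nilpotentField a₁ b₀ b₂) Set.univ
        (fun p : ℝ × ℝ =>
          (p.2 - p.1 ^ 2) * (p.2 + p.1 ^ 2) ^ 2 * Real.exp (-3 * b₂ * p.1)) := by
    rintro ⟨rfl, hb⟩
    obtain rfl : b₀ = -b₂ := by linarith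
    exact isAnalyticFirstIntegralOn_univ b₂
  exact ⟨⟨params_of_isAnalyticallyIntegrableAt, fun hab =>
    ⟨Set.univ, isOpen_univ, Set.mem_univ _, _, h hab⟩⟩, h⟩
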